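/- **Lemma.** Let $M$ be a smooth (Hausdorff, finite-dimensional, boundaryless) manifold with a symplectic form $\omega$ (a smooth, closed, nondegenerate $2$-form), let $H\colon M\to\mathbb{R}$ be smooth, and let $X_H$ be the Hamiltonian vector field, determined by $\omega(v,X_H)=\mathrm{d}H(v)$ for all tangent vectors $v$. Let $L\subseteq M$ be a connected Lagrangian submanifold, i.e. a connected (smoothly) embedded submanifold such that each tangent space $T_pL$ equals its own $\omega$-orthogonal complement in $T_pM$. Then: 1. $L$ is locally invariant under the flow of $X_H$ (whenever an integral curve $\gamma$ of $X_H$ satisfies $\gamma(t_0)\in L$, one has $\gamma(t)\in L$ for all $t$ sufficiently close to $t_0$) if and only if $L$ is contained in a level set $H^{-1}(c)$, $c\in\mathbb{R}$. 2. If moreover $L$ is a closed subset of $M$, then $L$ is invariant under the flow of $X_H$ (every integral curve of $X_H$ on an open interval which meets $L$ lies entirely in $L$) if and only if $L$ is contained in a level set $H^{-1}(c)$, $c\in\mathbb{R}$. -/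

import Mathlib

open Set Filter Topology Manifold
open scoped ContDiff

noncomputable section

namespace HamiltonianSystem

section Forms

variable {E : Type*} [NormedAddCommGroup E] [NormedSpace ℝ E]
  {M : Type*} [TopologicalSpace M] [ChartedSpace E M]

/-- The expression of a 2-form `Ω` on `M` in the preferred chart `φ` at `x₀`: the pullback
of `Ω` under `φ⁻¹`, a 2-form on the open set `φ.target` of `E` (its values off `φ.target`
have no meaning and are never used). -/
def formInChart (Ω : (x : M) → (TangentSpace 𝓘(ℝ, E) x) [⋀^Fin 2]→L[ℝ] ℝ) (x₀ : M) (y : E) :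
    E [⋀^Fin 2]→L[ℝ] ℝ :=
  (Ω ((chartAt E x₀).symm y)).compContinuousLinearMap
    (mfderiv 𝓘(ℝ, E) 𝓘(ℝ, E) (chartAt E x₀).symm y)

variable (E M) in
/-- A symplectic form on `M`: a smooth, closed, nondegenerate 2-form. Smoothness and closedness
are those of the expressions of the form in the charts of the atlas. -/
structure SymplecticForm where
  /-- The value of the form at a point. -/
  form : (x : M) → (TangentSpace 𝓘(ℝ, E) x) [⋀^Fin 2]→L[ℝ] ℝ
  smooth : ∀ x₀ : M, ContDiffOn ℝ ∞ (formInChart form x₀) (chartAt E x₀).target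
  closed : ∀ x₀ : M, ∀ y ∈ (chartAt E x₀).target, extDeriv (formInChart form x₀) y = 0
  nondegenerate : ∀ (x : M) (v : TangentSpace 𝓘(ℝ, E) x),
    (∀ w : TangentSpace 𝓘(ℝ, E) x, form x ![w, v] = 0) → v = 0

/-- By nondegeneracy, every covector `α` at `x` is `Ω(·, X)` for some tangent vector `X`. -/
theorem SymplecticForm.exists_vector [FiniteDimensional ℝ E] (Ω : SymplecticForm E M) (x : M)
    (α : TangentSpace 𝓘(ℝ, E) x →L[ℝ] ℝ) :
    ∃ X : TangentSpace 𝓘(ℝ, E) x, ∀ v : TangentSpace 𝓘(ℝ, E) x, Ω.form x ![v, X] = α v := by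
  have : FiniteDimensional ℝ (TangentSpace 𝓘(ℝ, E) x) := inferInstanceAs (FiniteDimensional ℝ E)
  have e₀ : ∀ v X Y : TangentSpace 𝓘(ℝ, E) x, Function.update ![v, X] 0 Y = ![Y, X] := by
    intro v X Y; ext i; fin_cases i <;> rfl
  have e₁ : ∀ v X Y : TangentSpace 𝓘(ℝ, E) x, Function.update ![v, X] 1 Y = ![v, Y] := by
    intro v X Y; ext i; fin_cases i <;> rfl
  let flat : TangentSpace 𝓘(ℝ, E) x →ₗ[ℝ] Module.Dual ℝ (TangentSpace 𝓘(ℝ, E) x) :=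
    LinearMap.mk₂ ℝ (fun X v => Ω.form x ![v, X])
      (fun X X' v => by simpa only [e₁] using (Ω.form x).map_update_add ![v, X] 1 X X')
      (fun c X v => by simpa only [e₁] using (Ω.form x).map_update_smul ![v, X] 1 c X)
      (fun X v v' => by simpa only [e₀] using (Ω.form x).map_update_add ![v, X] 0 v v')
      (fun c X v => by simpa only [e₀] using (Ω.form x).map_update_smul ![v, X] 0 c v)
  have hinj : Function.Injective flat := by
    rw [injective_iff_map_eq_zero]
    exact fun X hX => Ω.nondegenerate x X fun w => DFunLike.congr_fun hX w
  have hsurj : Function.Surjective flat :=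
    (LinearMap.injective_iff_surjective_of_finrank_eq_finrank
      (Subspace.dual_finrank_eq (K := ℝ)).symm).1 hinj
  obtain ⟨X, hX⟩ := hsurj α.toLinearMap
  exact ⟨X, fun v => DFunLike.congr_fun hX v⟩

/-- The Hamiltonian vector field `X_h` of `h`, determined by `Ω(v, X_h) = dh(v)` for all `v`. -/
def hamiltonianVectorField [FiniteDimensional ℝ E] (Ω : SymplecticForm E M) (h : M → ℝ) (x : M) :
    TangentSpace 𝓘(ℝ, E) x :=
  Classical.choose (Ω.exists_vector x (mfderiv 𝓘(ℝ, E) 𝓘(ℝ, ℝ) h x))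

theorem form_hamiltonianVectorField [FiniteDimensional ℝ E] (Ω : SymplecticForm E M) (h : M → ℝ)
    (x : M) (v : TangentSpace 𝓘(ℝ, E) x) :
    Ω.form x ![v, hamiltonianVectorField Ω h x] = mfderiv 𝓘(ℝ, E) 𝓘(ℝ, ℝ) h x v :=
  Classical.choose_spec (Ω.exists_vector x (mfderiv 𝓘(ℝ, E) 𝓘(ℝ, ℝ) h x)) v

/-- `L` is invariant under the (possibly only partially defined) flow of the vector field `X`:
an integral curve of `X` on an open interval that meets `L` stays in `L`. -/
def IsFlowInvariant (X : (x : M) → TangentSpace 𝓘(ℝ, E) x) (L : Set M) : Prop :=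
  ∀ (γ : ℝ → M) (a b : ℝ), IsMIntegralCurveOn γ X (Ioo a b) →
    ∀ t₀ ∈ Ioo a b, γ t₀ ∈ L → ∀ t ∈ Ioo a b, γ t ∈ L

/-- `L` is locally invariant under the flow of `X`: an integral curve of `X` that is in `L` at
time `t₀` is in `L` at all times near `t₀`. -/
def IsLocallyFlowInvariant (X : (x : M) → TangentSpace 𝓘(ℝ, E) x) (L : Set M) : Prop :=
  ∀ (γ : ℝ → M) (t₀ : ℝ), IsMIntegralCurveAt γ X t₀ → γ t₀ ∈ L → ∀ᶠ t in 𝓝 t₀, γ t ∈ L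

/-- A subset `L` of `M`, with the subspace topology and a smooth structure modelled on `F`, is
a Lagrangian submanifold of `(M, Ω)`: the inclusion is a smooth embedding, and each tangent space
of `L` (the image of the derivative of the inclusion) is its own `Ω`-orthogonal complement. -/
structure IsLagrangianSubmanifold {F : Type*} [NormedAddCommGroup F] [NormedSpace ℝ F]
    (Ω : SymplecticForm E M) (L : Set M) [ChartedSpace F L] : Prop where
  isManifold : IsManifold 𝓘(ℝ, F) ∞ L
  isSmoothEmbedding : IsSmoothEmbedding 𝓘(ℝ, F) 𝓘(ℝ, E) ∞ (Subtype.val : L → M)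
  lagrangian : ∀ (p : L) (w : TangentSpace 𝓘(ℝ, E) (p : M)),
    w ∈ range (mfderiv 𝓘(ℝ, F) 𝓘(ℝ, E) (Subtype.val : L → M) p) ↔
      ∀ u : TangentSpace 𝓘(ℝ, F) p,
        Ω.form p ![mfderiv 𝓘(ℝ, F) 𝓘(ℝ, E) (Subtype.val : L → M) p u, w] = 0

end Forms

end HamiltonianSystem

end

namespace HamiltonianSystem

/-! For `u` tangent to `L` at `p`, `Ω(u, X_h) = dh(u)`. As `T_pL` is its own orthogonal complement,
`X_h(p)` lies in `T_pL` exactly when `dh` vanishes on `T_pL`. Over all `p`, and with `L` connected,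
tangency of `X_h` to `L` therefore means that `h` is constant on `L`
(`hamiltonianVectorField_tangent_iff`).

It remains to identify tangency with local invariance. If integral curves stay in `L`,
differentiating them gives tangency (`tangent_of_isLocallyFlowInvariant`). Conversely, in charts
making `L` a linear subspace, uniqueness for ODEs keeps a curve in `L`
(`isLocallyFlowInvariant_of_tangent`). Both need `X_h` to be `C^1`, which follows by inverting the
form in a chart. If `L` is closed, the times a curve spends in `L` form a clopen subset of an
interval, so local invariance becomes global. -/

theorem two_le_infty : (2 : ℕ∞ω) ≤ ∞ :=
  show ((2 : ℕ∞) : ℕ∞ω) ≤ ∞ from mod_cast le_top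

/-! ### ODE uniqueness relative to a linear subspace -/

section ODE

variable {E F G : Type*} [NormedAddCommGroup E] [NormedSpace ℝ E] [NormedAddCommGroup F]
  [NormedSpace ℝ F] [NormedAddCommGroup G] [NormedSpace ℝ G]

/-- A solution of an autonomous ODE that starts on a linear subspace to which the `C^1` right-hand
side is tangent stays on this subspace for a short time. -/
theorem eventually_snd_eq_zero_of_hasDerivAt (e : (F × G) ≃L[ℝ] E) {W : E → E} {c : ℝ → E} {t₀ : ℝ}
    (hW : ContDiffAt ℝ 1 W (c t₀)) (hc : ∀ᶠ t in 𝓝 t₀, HasDerivAt c (W (c t)) t)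
    (h₀ : (e.symm (c t₀)).2 = 0)
    (htan : ∀ᶠ u in 𝓝 (e.symm (c t₀)).1, (e.symm (W (e (u, 0)))).2 = 0) :
    ∀ᶠ t in 𝓝 t₀, (e.symm (c t)).2 = 0 := by
  have hcont : ContinuousAt c t₀ := hc.self_of_nhds.continuousAt
  let P : E →L[ℝ] G := (ContinuousLinearMap.snd ℝ F G).comp (e.symm : E →L[ℝ] F × G)
  let R : F × G → G := fun z => P (W (e z))
  have hp : e (e.symm (c t₀)) = c t₀ := e.apply_symm_apply _
  have hR : ContDiffAt ℝ 1 R (e.symm (c t₀)) := by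
    refine P.contDiff.contDiffAt.comp _ (ContDiffAt.comp _ ?_ e.contDiff.contDiffAt)
    rwa [hp]
  obtain ⟨K, T, hT, hK⟩ := hR.exists_lipschitzOnWith
  obtain ⟨U, hU, V, hV, hUV⟩ := mem_nhds_prod_iff.1 (by
    simpa only [Prod.eta] using hT : T ∈ 𝓝 ((e.symm (c t₀)).1, (e.symm (c t₀)).2))
  rw [h₀] at hV
  have ha : ContinuousAt (fun t => (e.symm (c t)).1) t₀ :=
    (continuous_fst.comp e.symm.continuous).continuousAt.comp hcont
  have hb : ContinuousAt (fun t => (e.symm (c t)).2) t₀ :=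
    (continuous_snd.comp e.symm.continuous).continuousAt.comp hcont
  have hall : ∀ᶠ t in 𝓝 t₀, HasDerivAt c (W (c t)) t ∧ (e.symm (c t)).1 ∈ U ∧
      (e.symm (c t)).2 ∈ V ∧ (e.symm (W (e ((e.symm (c t)).1, 0)))).2 = 0 :=
    hc.and ((ha.eventually_mem hU).and ((hb.eventually_mem (by rwa [h₀])).and (ha.eventually htan)))
  obtain ⟨ε, hε, hball⟩ := Metric.eventually_nhds_iff_ball.1 hall
  rw [Real.ball_eq_Ioo] at hball
  have ht₀ : t₀ ∈ Ioo (t₀ - ε) (t₀ + ε) := by constructor <;> linarith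
  -- With the first component `a` of the solution regarded as known, the second solves the
  -- time-dependent equation `y' = R (a t, y)`. Tangency makes `y = 0` a solution too, and the two
  -- agree at `t₀`.
  have key : EqOn (fun t => (e.symm (c t)).2) (fun _ => (0 : G)) (Ioo (t₀ - ε) (t₀ + ε)) := by
    refine ODE_solution_unique_of_mem_Ioo (v := fun t x => R ((e.symm (c t)).1, x))
      (s := fun _ => V) (K := K) ?_ ht₀ ?_ ?_ h₀
    · intro t ht x hx y hy
      have := hK (hUV (mk_mem_prod (hball t ht).2.1 hx)) (hUV (mk_mem_prod (hball t ht).2.1 hy))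
      simpa [Prod.edist_eq] using this
    · intro t ht
      refine ⟨?_, (hball t ht).2.2.1⟩
      have : HasDerivAt (fun t => P (c t)) (P (W (c t))) t :=
        P.hasFDerivAt.comp_hasDerivAt t (hball t ht).1
      simpa [R, P] using this
    · intro t ht
      refine ⟨?_, mem_of_mem_nhds hV⟩
      have : R ((e.symm (c t)).1, 0) = 0 := (hball t ht).2.2.2
      rw [this]
      exact hasDerivAt_const t (0 : G)
  filter_upwards [Ioo_mem_nhds ht₀.1 ht₀.2] with t ht using key ht

end ODE

/-! ### Regularity of the Hamiltonian vector field in charts -/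

section Smoothness

variable {E : Type*} [NormedAddCommGroup E] [NormedSpace ℝ E]

variable (E) in
/-- The map `X ↦ η(X, ·)` of a 2-form `η`, as a continuous linear function of `η`. -/
noncomputable def flatL : (E [⋀^Fin 2]→L[ℝ] ℝ) →L[ℝ] E →L[ℝ] E →L[ℝ] ℝ :=
  (ContinuousLinearMap.compL ℝ E (E [⋀^Fin 1]→L[ℝ] ℝ) (E →L[ℝ] ℝ)
    ((ContinuousAlternatingMap.ofSubsingletonLIE (𝕜 := ℝ) (E := E) (F := ℝ)
      (0 : Fin 1)).symm.toContinuousLinearEquiv :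
      (E [⋀^Fin 1]→L[ℝ] ℝ) →L[ℝ] E →L[ℝ] ℝ)).comp
    (ContinuousAlternatingMap.curryLeftLI (𝕜 := ℝ) (E := E) (F := ℝ) (n := 1)).toContinuousLinearMap

theorem flatL_apply (η : E [⋀^Fin 2]→L[ℝ] ℝ) (X v : E) : flatL E η X v = η ![X, v] := by
  change η (Matrix.vecCons X (fun _ => v)) = _
  congr 1
  ext i; fin_cases i <;> rfl

theorem form_swap {T : Type*} [AddCommGroup T] [Module ℝ T] [TopologicalSpace T]
    (η : T [⋀^Fin 2]→L[ℝ] ℝ) (v w : T) : η ![v, w] = -η ![w, v] := by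
  have := η.toAlternatingMap.map_swap ![w, v] (i := 0) (j := 1) (by decide)
  refine Eq.trans ?_ this
  change η _ = η _
  congr 1
  ext i; fin_cases i <;> rfl

theorem isInvertible_flatL [FiniteDimensional ℝ E] {η : E [⋀^Fin 2]→L[ℝ] ℝ}
    (hη : ∀ v, (∀ w, η ![w, v] = 0) → v = 0) : (flatL E η).IsInvertible := by
  have hinj : Function.Injective (flatL E η) := by
    rw [injective_iff_map_eq_zero]
    intro X hX
    refine hη X fun w => ?_
    rw [form_swap, ← flatL_apply, hX]
    simp
  have hdim : Module.finrank ℝ E = Module.finrank ℝ (E →L[ℝ] ℝ) := by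
    rw [← (LinearMap.toContinuousLinearMap (𝕜 := ℝ) (E := E) (F' := ℝ)).finrank_eq]
    exact (Subspace.dual_finrank_eq (K := ℝ)).symm
  have : FiniteDimensional ℝ (E →L[ℝ] ℝ) := inferInstance
  refine ⟨(LinearEquiv.ofInjectiveOfFinrankEq (flatL E η : E →ₗ[ℝ] E →L[ℝ] ℝ)
    hinj hdim).toContinuousLinearEquiv, ?_⟩
  ext X : 1
  rfl

variable {M : Type*} [TopologicalSpace M] [ChartedSpace E M]

theorem formInChart_apply (Ω : SymplecticForm E M) (x₀ : M) (y v w : E) :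
    formInChart Ω.form x₀ y ![v, w] = Ω.form ((chartAt E x₀).symm y)
      ![mfderiv 𝓘(ℝ, E) 𝓘(ℝ, E) (chartAt E x₀).symm y v,
        mfderiv 𝓘(ℝ, E) 𝓘(ℝ, E) (chartAt E x₀).symm y w] := by
  change Ω.form _ _ = _
  congr 1
  ext i; fin_cases i <;> rfl

/-- The expression of a vector field in a chart. -/
noncomputable def vectorFieldInChart (X : (x : M) → TangentSpace 𝓘(ℝ, E) x)
    (e : OpenPartialHomeomorph M E) (y : E) : E :=
  mfderiv 𝓘(ℝ, E) 𝓘(ℝ, E) e (e.symm y) (X (e.symm y))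

theorem vectorFieldInChart_apply (X : (x : M) → TangentSpace 𝓘(ℝ, E) x)
    {e : OpenPartialHomeomorph M E} {x : M} (hx : x ∈ e.source) :
    vectorFieldInChart X e (e x) = mfderiv 𝓘(ℝ, E) 𝓘(ℝ, E) e x (X x) := by
  -- The point is generalized because the type of `X z` depends on `z`, which obstructs rewriting in
  -- place.
  have : ∀ z, z = x → (mfderiv 𝓘(ℝ, E) 𝓘(ℝ, E) e z (X z) : E) =
      mfderiv 𝓘(ℝ, E) 𝓘(ℝ, E) e x (X x) := by
    rintro _ rfl; rfl
  exact this _ (e.left_inv hx)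

theorem mfderiv_symm_vectorFieldInChart (X : (x : M) → TangentSpace 𝓘(ℝ, E) x)
    {e : OpenPartialHomeomorph M E} (he : e.MDifferentiable 𝓘(ℝ, E) 𝓘(ℝ, E)) {y : E}
    (hy : y ∈ e.target) :
    mfderiv 𝓘(ℝ, E) 𝓘(ℝ, E) e.symm y (vectorFieldInChart (E := E) X e y) = X (e.symm y) := by
  obtain ⟨u, hu⟩ : ∃ u : E, mfderiv 𝓘(ℝ, E) 𝓘(ℝ, E) e.symm y u = X (e.symm y) :=
    he.symm.mfderiv_surjective hy (X (e.symm y))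
  have h1 : vectorFieldInChart X e y = u :=
    (congrArg (mfderiv 𝓘(ℝ, E) 𝓘(ℝ, E) e (e.symm y)) hu.symm).trans
      (DFunLike.congr_fun (he.comp_symm_deriv hy) u)
  exact (congrArg (mfderiv 𝓘(ℝ, E) 𝓘(ℝ, E) e.symm y) h1).trans hu

/-- The expression in `ψ` is the derivative of the transition map applied to the expression in `φ`;
that derivative is `C^1` because the transition is `C^2`. This passes from the preferred charts,
where the form is known to be smooth, to the charts adapted to an immersion. -/
theorem contDiffAt_vectorFieldInChart_of_mem_maximalAtlas {X : (x : M) → TangentSpace 𝓘(ℝ, E) x}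
    {φ ψ : OpenPartialHomeomorph M E} (hφ : φ ∈ IsManifold.maximalAtlas 𝓘(ℝ, E) ∞ M)
    (hψ : ψ ∈ IsManifold.maximalAtlas 𝓘(ℝ, E) ∞ M) {x₀ : M} (hxφ : x₀ ∈ φ.source)
    (hxψ : x₀ ∈ ψ.source) (hX : ContDiffAt ℝ 1 (vectorFieldInChart X φ) (φ x₀)) :
    ContDiffAt ℝ 1 (vectorFieldInChart X ψ) (ψ x₀) := by
  have transition : ∀ {e e' : OpenPartialHomeomorph M E},
      e ∈ IsManifold.maximalAtlas 𝓘(ℝ, E) ∞ M → e' ∈ IsManifold.maximalAtlas 𝓘(ℝ, E) ∞ M →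
      ∀ {x : M}, x ∈ e.source → x ∈ e'.source → ContDiffAt ℝ 2 (e' ∘ e.symm) (e x) := by
    intro e e' he he' x hx hx'
    rw [← contMDiffAt_iff_contDiffAt]
    refine ContMDiffAt.of_le (n := ∞) (ContMDiffAt.comp (I' := 𝓘(ℝ, E)) (e x) ?_
      (contMDiffAt_symm_of_mem_maximalAtlas he (e.map_source hx))) two_le_infty
    rw [e.left_inv hx]
    exact contMDiffAt_of_mem_maximalAtlas he' hx'
  have hk : (φ ∘ ψ.symm) (ψ x₀) = φ x₀ := by simp [ψ.left_inv hxψ]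
  have hkd : ContDiffAt ℝ 1 (φ ∘ ψ.symm) (ψ x₀) := (transition hψ hφ hxψ hxφ).of_le (by norm_num)
  have hg : ContDiffAt ℝ 1 (fderiv ℝ (ψ ∘ φ.symm)) (φ x₀) :=
    (transition hφ hψ hxφ hxψ).fderiv_right (by norm_num)
  have h1 : ContDiffAt ℝ 1 (fun y => fderiv ℝ (ψ ∘ φ.symm) ((φ ∘ ψ.symm) y)
      (vectorFieldInChart X φ ((φ ∘ ψ.symm) y))) (ψ x₀) :=
    (ContDiffAt.comp (ψ x₀) (by rwa [hk]) hkd).clm_apply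
      (ContDiffAt.fun_comp (g := vectorFieldInChart X φ) (ψ x₀) (by rwa [hk]) hkd)
  refine h1.congr_of_eventuallyEq ?_
  have hs : ψ.symm ⁻¹' φ.source ∈ 𝓝 (ψ x₀) :=
    (ψ.continuousAt_symm (ψ.map_source hxψ)).preimage_mem_nhds
      (φ.open_source.mem_nhds (by rwa [ψ.left_inv hxψ]))
  filter_upwards [hs, ψ.open_target.mem_nhds (ψ.map_source hxψ)] with y hy hyt
  obtain ⟨x, hx, rfl⟩ : ∃ x ∈ ψ.source, ψ x = y :=
    ⟨ψ.symm y, ψ.map_target hyt, ψ.right_inv hyt⟩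
  have hxφ' : x ∈ φ.source := by simpa [ψ.left_inv hx] using hy
  have hkx : (φ ∘ ψ.symm) (ψ x) = φ x := by simp [ψ.left_inv hx]
  rw [hkx, vectorFieldInChart_apply X hx]
  refine Eq.trans ?_ (congrArg (fderiv ℝ (ψ ∘ φ.symm) (φ x))
    (vectorFieldInChart_apply X hxφ').symm)
  have hcomp : mfderiv 𝓘(ℝ, E) 𝓘(ℝ, E) ψ x = (mfderiv 𝓘(ℝ, E) 𝓘(ℝ, E) (ψ ∘ φ.symm) (φ x)).comp
      (mfderiv 𝓘(ℝ, E) 𝓘(ℝ, E) φ x) := by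
    rw [← mfderiv_comp (I' := 𝓘(ℝ, E)) x ((transition hφ hψ hxφ' hx).differentiableAt
      (by simp)).mdifferentiableAt
      ((contMDiffAt_of_mem_maximalAtlas hφ hxφ').mdifferentiableAt (by simp))]
    refine Filter.EventuallyEq.mfderiv_eq ?_
    filter_upwards [φ.open_source.mem_nhds hxφ'] with z hz
    simp [φ.left_inv hz]
  rw [← mfderiv_eq_fderiv]
  exact DFunLike.congr_fun hcomp (X x)

/-- In a chart, an integral curve of a vector field solves the corresponding ODE. -/
theorem hasDerivAt_comp_of_hasMFDerivAt {X : (x : M) → TangentSpace 𝓘(ℝ, E) x}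
    {ψ : OpenPartialHomeomorph M E} (hψ : ψ ∈ IsManifold.maximalAtlas 𝓘(ℝ, E) ∞ M)
    {γ : ℝ → M} {t : ℝ} (ht : γ t ∈ ψ.source)
    (hγ : HasMFDerivAt 𝓘(ℝ, ℝ) 𝓘(ℝ, E) γ t ((1 : ℝ →L[ℝ] ℝ).smulRight (X (γ t)))) :
    HasDerivAt (ψ ∘ γ) (vectorFieldInChart X ψ (ψ (γ t))) t := by
  have h1 := HasMFDerivAt.comp t ((contMDiffAt_of_mem_maximalAtlas hψ ht).mdifferentiableAt
    (by simp)).hasMFDerivAt hγ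
  have h2 := HasFDerivAt.congr_fderiv (hasMFDerivAt_iff_hasFDerivAt.1 h1)
    (g' := (1 : ℝ →L[ℝ] ℝ).smulRight (vectorFieldInChart X ψ (ψ (γ t)))) (by
      rw [vectorFieldInChart_apply X ht]
      ext
      exact ((mfderiv 𝓘(ℝ, E) 𝓘(ℝ, E) ψ (γ t)).map_smul (1 : ℝ) (X (γ t))))
  simpa using h2.hasDerivAt

variable [IsManifold 𝓘(ℝ, E) ∞ M]

theorem isInvertible_flatL_formInChart [FiniteDimensional ℝ E] (Ω : SymplecticForm E M) (x₀ : M)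
    {y : E} (hy : y ∈ (chartAt E x₀).target) :
    (flatL E (formInChart Ω.form x₀ y)).IsInvertible := by
  have : IsManifold 𝓘(ℝ, E) 1 M := .of_le (n := ∞) (by simp)
  have hd := (mdifferentiable_chart (I := 𝓘(ℝ, E)) x₀).symm
  refine isInvertible_flatL fun v hv => hd.mfderiv_injective hy (Eq.trans ?_
    (map_zero (mfderiv 𝓘(ℝ, E) 𝓘(ℝ, E) (chartAt E x₀).symm y)).symm)
  refine Ω.nondegenerate _ _ fun w => ?_
  obtain ⟨w', rfl⟩ := hd.mfderiv_surjective hy w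
  exact (formInChart_apply Ω x₀ y w' v).symm.trans (hv w')

/-- This linear equation determines the field in the chart. The sign arises because `flatL` puts the
field in the first slot, whereas the Hamiltonian convention puts it in the second. -/
theorem flatL_formInChart_vectorFieldInChart [FiniteDimensional ℝ E] (Ω : SymplecticForm E M)
    {h : M → ℝ} (hh : ContMDiff 𝓘(ℝ, E) 𝓘(ℝ, ℝ) ∞ h) (x₀ : M)
    {y : E} (hy : y ∈ (chartAt E x₀).target) :
    flatL E (formInChart Ω.form x₀ y)
      (vectorFieldInChart (hamiltonianVectorField Ω h) (chartAt E x₀) y) =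
      -fderiv ℝ (h ∘ (chartAt E x₀).symm) y := by
  have : IsManifold 𝓘(ℝ, E) 1 M := .of_le (n := ∞) (by simp)
  have hd := mdifferentiable_chart (I := 𝓘(ℝ, E)) x₀
  ext v
  rw [flatL_apply, form_swap, formInChart_apply]
  rw [neg_apply, neg_inj]
  rw [mfderiv_symm_vectorFieldInChart _ hd hy, form_hamiltonianVectorField, ← mfderiv_eq_fderiv,
    mfderiv_comp (I' := 𝓘(ℝ, E)) y (hh.mdifferentiable (by simp) _) (hd.symm.mdifferentiableAt hy)]
  rfl

theorem contDiffAt_vectorFieldInChart_chartAt [FiniteDimensional ℝ E] (Ω : SymplecticForm E M)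
    {h : M → ℝ} (hh : ContMDiff 𝓘(ℝ, E) 𝓘(ℝ, ℝ) ∞ h) (x₀ : M)
    {y : E} (hy : y ∈ (chartAt E x₀).target) :
    ContDiffAt ℝ 1 (vectorFieldInChart (hamiltonianVectorField Ω h) (chartAt E x₀)) y := by
  have hnhds := (chartAt E x₀).open_target.mem_nhds hy
  have hη : ContDiffAt ℝ 1 (fun z => flatL E (formInChart Ω.form x₀ z)) y :=
    ContDiffAt.comp y (ContinuousLinearMap.contDiff (𝕜 := ℝ) (E := E [⋀^Fin 2]→L[ℝ] ℝ)
      (F := E →L[ℝ] E →L[ℝ] ℝ) (flatL E)).contDiffAt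
      (((Ω.smooth x₀).contDiffAt hnhds).of_le (m := 1) (by simp))
  -- Inversion of continuous linear maps is smooth at invertible ones, so solving for the field
  -- loses no regularity.
  have hinv : ContDiffAt ℝ 1 (fun z => (flatL E (formInChart Ω.form x₀ z)).inverse) y :=
    (isInvertible_flatL_formInChart Ω x₀ hy).contDiffAt_map_inverse.fun_comp y hη
  have hcomp : ContDiffAt ℝ 2 (h ∘ (chartAt E x₀).symm) y := by
    rw [← contMDiffAt_iff_contDiffAt]
    exact ((hh _).comp y (contMDiffAt_symm_of_mem_maximalAtlas
      (IsManifold.chart_mem_maximalAtlas x₀) hy)).of_le two_le_infty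
  have hdh : ContDiffAt ℝ 1 (fun z => -fderiv ℝ (h ∘ (chartAt E x₀).symm) z) y :=
    (hcomp.fderiv_right (m := 1) (by norm_num)).neg
  refine (hinv.clm_apply hdh).congr_of_eventuallyEq ?_
  filter_upwards [hnhds] with z hz
  rw [← flatL_formInChart_vectorFieldInChart Ω hh x₀ hz]
  obtain ⟨A, hA⟩ := isInvertible_flatL_formInChart Ω x₀ hz
  rw [← hA, ContinuousLinearMap.inverse_equiv]
  simp

/-- The Hamiltonian vector field of a smooth function is `C^1`. -/
theorem contMDiffAt_hamiltonianVectorField [FiniteDimensional ℝ E] (Ω : SymplecticForm E M)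
    {h : M → ℝ} (hh : ContMDiff 𝓘(ℝ, E) 𝓘(ℝ, ℝ) ∞ h) (x₀ : M)
    [IsManifold 𝓘(ℝ, E) 1 M] :
    ContMDiffAt 𝓘(ℝ, E) 𝓘(ℝ, E).tangent 1
      (fun x => (⟨x, hamiltonianVectorField Ω h x⟩ : TangentBundle 𝓘(ℝ, E) M)) x₀ := by
  have : IsManifold 𝓘(ℝ, E) (1 + 1) M := .of_le (n := ∞) two_le_infty
  have : ContMDiffVectorBundle 1 E (TangentSpace 𝓘(ℝ, E) : M → Type _) 𝓘(ℝ, E) :=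
    TangentBundle.contMDiffVectorBundle (n := 1)
  refine (Bundle.contMDiffAt_section x₀).2 ?_
  have hx₀ := mem_chart_source E x₀
  have hW := (contDiffAt_vectorFieldInChart_chartAt Ω hh x₀
    ((chartAt E x₀).map_source hx₀)).contMDiffAt.comp x₀ (contMDiffAt_of_mem_maximalAtlas
      (I := 𝓘(ℝ, E)) (IsManifold.chart_mem_maximalAtlas x₀) hx₀)
  refine hW.congr_of_eventuallyEq ?_
  filter_upwards [(chartAt E x₀).open_source.mem_nhds hx₀] with x hx
  have h1 := (Bundle.Trivialization.continuousLinearMapAt_apply_of_mem (R := ℝ)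
    (trivializationAt E (TangentSpace 𝓘(ℝ, E)) x₀) (b := x) (by simpa using hx)
    (hamiltonianVectorField Ω h x)).symm.trans (DFunLike.congr_fun
    (TangentBundle.continuousLinearMapAt_trivializationAt (I := 𝓘(ℝ, E)) (𝕜 := ℝ) hx)
    (hamiltonianVectorField Ω h x))
  exact h1.trans (vectorFieldInChart_apply _ hx).symm

theorem contDiffAt_vectorFieldInChart [FiniteDimensional ℝ E] (Ω : SymplecticForm E M)
    {h : M → ℝ} (hh : ContMDiff 𝓘(ℝ, E) 𝓘(ℝ, ℝ) ∞ h) {ψ : OpenPartialHomeomorph M E}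
    (hψ : ψ ∈ IsManifold.maximalAtlas 𝓘(ℝ, E) ∞ M) {x₀ : M} (hx₀ : x₀ ∈ ψ.source) :
    ContDiffAt ℝ 1 (vectorFieldInChart (hamiltonianVectorField Ω h) ψ) (ψ x₀) :=
  contDiffAt_vectorFieldInChart_of_mem_maximalAtlas (IsManifold.chart_mem_maximalAtlas x₀) hψ
    (mem_chart_source E x₀) hx₀ (contDiffAt_vectorFieldInChart_chartAt Ω hh x₀
      ((chartAt E x₀).map_source (mem_chart_source E x₀)))

end Smoothness

/-! ### Tangent spaces and locally constant functions -/

section Submanifold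

variable {E : Type*} [NormedAddCommGroup E] [NormedSpace ℝ E]
  {M : Type*} [TopologicalSpace M] [ChartedSpace E M]
  {F : Type*} [NormedAddCommGroup F] [NormedSpace ℝ F]

/-- Around each point, the tangent vectors of an immersed manifold are the vectors whose transversal
component vanishes in charts in which the immersion is linear. -/
theorem mem_range_mfderiv_iff {N : Type*} [TopologicalSpace N] [ChartedSpace F N]
    {G : Type*} [NormedAddCommGroup G] [NormedSpace ℝ G]
    {f : N → M} (hf : MDifferentiable 𝓘(ℝ, F) 𝓘(ℝ, E) f)
    {φ : OpenPartialHomeomorph N F} {ψ : OpenPartialHomeomorph M E} {e : (F × G) ≃L[ℝ] E}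
    (hφ : φ ∈ IsManifold.maximalAtlas 𝓘(ℝ, F) ∞ N) (hψ : ψ ∈ IsManifold.maximalAtlas 𝓘(ℝ, E) ∞ M)
    (hmaps : MapsTo f φ.source ψ.source) (heq : ∀ q ∈ φ.source, ψ (f q) = e (φ q, 0))
    {q : N} (hq : q ∈ φ.source) (w : TangentSpace 𝓘(ℝ, E) (f q)) :
    w ∈ range (mfderiv 𝓘(ℝ, F) 𝓘(ℝ, E) f q) ↔
      (e.symm (mfderiv 𝓘(ℝ, E) 𝓘(ℝ, E) ψ (f q) w)).2 = 0 := by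
  have hφd : φ.MDifferentiable 𝓘(ℝ, F) 𝓘(ℝ, F) :=
    ⟨(contMDiffOn_of_mem_maximalAtlas hφ).mdifferentiableOn (by simp),
      (contMDiffOn_symm_of_mem_maximalAtlas hφ).mdifferentiableOn (by simp)⟩
  have hψd : ψ.MDifferentiable 𝓘(ℝ, E) 𝓘(ℝ, E) :=
    ⟨(contMDiffOn_of_mem_maximalAtlas hψ).mdifferentiableOn (by simp),
      (contMDiffOn_symm_of_mem_maximalAtlas hψ).mdifferentiableOn (by simp)⟩
  let A : F →L[ℝ] E := (e : F × G →L[ℝ] E).comp (ContinuousLinearMap.inl ℝ F G)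
  have hcomp : (mfderiv 𝓘(ℝ, E) 𝓘(ℝ, E) ψ (f q)).comp (mfderiv 𝓘(ℝ, F) 𝓘(ℝ, E) f q) =
      A.comp (mfderiv 𝓘(ℝ, F) 𝓘(ℝ, F) φ q) := by
    rw [← mfderiv_comp q (hψd.mdifferentiableAt (hmaps hq)) (hf q)]
    have h1 : mfderiv 𝓘(ℝ, F) 𝓘(ℝ, E) (ψ ∘ f) q = mfderiv 𝓘(ℝ, F) 𝓘(ℝ, E) (A ∘ φ) q := by
      refine Filter.EventuallyEq.mfderiv_eq ?_
      filter_upwards [φ.open_source.mem_nhds hq] with z hz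
      simpa [A] using heq z hz
    rw [h1, mfderiv_comp (I' := 𝓘(ℝ, F)) q A.differentiableAt.mdifferentiableAt
      (hφd.mdifferentiableAt hq), mfderiv_eq_fderiv, A.fderiv]
    rfl
  have key : ∀ v, (mfderiv 𝓘(ℝ, E) 𝓘(ℝ, E) ψ (f q) (mfderiv 𝓘(ℝ, F) 𝓘(ℝ, E) f q v) : E) =
      e ((mfderiv 𝓘(ℝ, F) 𝓘(ℝ, F) φ q v : F), 0) := fun v => DFunLike.congr_fun hcomp v
  constructor
  · rintro ⟨v, rfl⟩
    have := congrArg (fun z : E => (e.symm z).2) (key v)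
    exact this.trans (by simp)
  · intro hw
    obtain ⟨v, hv⟩ := hφd.mfderiv_surjective hq
      (e.symm (mfderiv 𝓘(ℝ, E) 𝓘(ℝ, E) ψ (f q) w)).1
    refine ⟨v, hψd.mfderiv_injective (hmaps hq) ((key v).trans ?_)⟩
    rw [hv, ← hw]
    exact e.apply_symm_apply _

theorem exists_forall_eq_of_mfderiv_eq_zero {N : Type*} [TopologicalSpace N] [ChartedSpace F N]
    [IsManifold 𝓘(ℝ, F) ∞ N] [PreconnectedSpace N] {f : N → ℝ}
    (hf : MDifferentiable 𝓘(ℝ, F) 𝓘(ℝ, ℝ) f)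
    (hf' : ∀ q v, mfderiv 𝓘(ℝ, F) 𝓘(ℝ, ℝ) f q v = 0) : ∃ c, ∀ q, f q = c := by
  have : IsManifold 𝓘(ℝ, F) 1 N := .of_le (n := ∞) (by simp)
  have hloc : IsLocallyConstant f := by
    rw [IsLocallyConstant.iff_eventually_eq]
    intro p
    have hφd := mdifferentiable_chart (I := 𝓘(ℝ, F)) p
    set φ := chartAt F p
    have hp : p ∈ φ.source := mem_chart_source F p
    obtain ⟨r, hr, hball⟩ := Metric.isOpen_iff.1 φ.open_target (φ p) (φ.map_source hp)
    have hd : ∀ y ∈ Metric.ball (φ p) r, HasFDerivAt (f ∘ φ.symm) (0 : F →L[ℝ] ℝ) y := by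
      intro y hy
      have h1 := HasMFDerivAt.comp y (hf (φ.symm y)).hasMFDerivAt
        (hφd.symm.mdifferentiableAt (hball hy)).hasMFDerivAt
      refine HasFDerivAt.congr_fderiv (hasMFDerivAt_iff_hasFDerivAt.1 h1) ?_
      ext v
      exact hf' _ _
    have hconst : ∀ y ∈ Metric.ball (φ p) r, (f ∘ φ.symm) y = (f ∘ φ.symm) (φ p) := by
      intro y hy
      refine (convex_ball (φ p) r).is_const_of_fderivWithin_eq_zero (𝕜 := ℝ)
        (fun z hz => (hd z hz).differentiableAt.differentiableWithinAt) (fun z hz => ?_) hy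
        (Metric.mem_ball_self hr)
      exact (hd z hz).hasFDerivWithinAt.fderivWithin (Metric.isOpen_ball.uniqueDiffWithinAt hz)
    filter_upwards [φ.open_source.mem_nhds hp,
      (φ.continuousAt hp).preimage_mem_nhds (Metric.ball_mem_nhds _ hr)] with q hq hqb
    simpa [φ.left_inv hq, φ.left_inv hp] using hconst _ hqb
  -- Preconnectedness allows `N` to be empty, where any constant serves.
  rcases isEmpty_or_nonempty N with hN | ⟨⟨p⟩⟩
  · exact ⟨0, fun q => hN.elim q⟩
  · exact ⟨f p, fun q => hloc.apply_eq_of_preconnectedSpace q p⟩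

end Submanifold

/-! ### Tangency and local invariance -/

section Invariance

universe u

variable {E : Type u} [NormedAddCommGroup E] [NormedSpace ℝ E]
  {M : Type*} [TopologicalSpace M] [ChartedSpace E M]
  {F : Type*} [NormedAddCommGroup F] [NormedSpace ℝ F]

/-- An immersion is linear in suitable charts. -/
theorem exists_charts_of_isImmersionAt {N : Type*} [TopologicalSpace N] [ChartedSpace F N]
    {f : N → M} {p : N} (hf : IsImmersionAt 𝓘(ℝ, F) 𝓘(ℝ, E) ∞ f p) :
    ∃ (G : Type u) (_ : NormedAddCommGroup G) (_ : NormedSpace ℝ G) (e : (F × G) ≃L[ℝ] E),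
      ∃ φ ∈ IsManifold.maximalAtlas 𝓘(ℝ, F) ∞ N, ∃ ψ ∈ IsManifold.maximalAtlas 𝓘(ℝ, E) ∞ M,
        p ∈ φ.source ∧ MapsTo f φ.source ψ.source ∧ ∀ q ∈ φ.source, ψ (f q) = e (φ q, 0) := by
  refine ⟨hf.complement, inferInstance, inferInstance, hf.equiv, hf.domChart,
    hf.domChart_mem_maximalAtlas, hf.codChart, hf.codChart_mem_maximalAtlas,
    hf.mem_domChart_source, hf.source_subset_preimage_source, fun q hq => ?_⟩
  have hmem : hf.domChart q ∈ (hf.domChart.extend 𝓘(ℝ, F)).target := by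
    simpa using hf.domChart.map_source hq
  have := hf.writtenInCharts hmem
  simpa [hf.domChart.left_inv hq] using this

/-- A submanifold to which a `C^1` vector field is tangent is locally invariant under its flow. -/
theorem isLocallyFlowInvariant_of_tangent {X : (x : M) → TangentSpace 𝓘(ℝ, E) x} {L : Set M}
    [ChartedSpace F L] (hL : IsSmoothEmbedding 𝓘(ℝ, F) 𝓘(ℝ, E) ∞ (Subtype.val : L → M))
    (hX : ∀ ψ ∈ IsManifold.maximalAtlas 𝓘(ℝ, E) ∞ M, ∀ x ∈ ψ.source,
      ContDiffAt ℝ 1 (vectorFieldInChart X ψ) (ψ x))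
    (htan : ∀ q : L, X q ∈ range (mfderiv 𝓘(ℝ, F) 𝓘(ℝ, E) (Subtype.val : L → M) q)) :
    IsLocallyFlowInvariant X L := by
  intro γ t₀ hγ hγ₀
  obtain ⟨p, hp⟩ : ∃ p : L, (p : M) = γ t₀ := ⟨⟨γ t₀, hγ₀⟩, rfl⟩
  obtain ⟨G, _, _, e, φ, hφ, ψ, hψ, hpφ, hmaps, heq⟩ :=
    exists_charts_of_isImmersionAt (hL.isImmersion.isImmersionAt p)
  have hdiff : MDifferentiable 𝓘(ℝ, F) 𝓘(ℝ, E) (Subtype.val : L → M) :=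
    hL.isImmersion.contMDiff.mdifferentiable (by simp)
  have hγs : γ t₀ ∈ ψ.source := hp ▸ hmaps hpφ
  have hsrc : ∀ᶠ t in 𝓝 t₀, γ t ∈ ψ.source :=
    hγ.continuousAt.eventually_mem (ψ.open_source.mem_nhds hγs)
  have hsymm : e.symm (ψ (γ t₀)) = (φ p, 0) := by
    rw [← hp, heq p hpφ, e.symm_apply_apply]
  have hcont : ContinuousAt (fun t => (e.symm (ψ (γ t))).1) t₀ :=
    (continuous_fst.comp e.symm.continuous).continuousAt.comp
      ((ψ.continuousAt hγs).comp hγ.continuousAt)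
  have hφp : φ.target ∈ 𝓝 (e.symm (ψ (γ t₀))).1 := by
    rw [hsymm]
    exact φ.open_target.mem_nhds (φ.map_source hpφ)
  have hpoint : ∀ u ∈ φ.target, ψ (φ.symm u : L) = e (u, 0) := fun u hu => by
    rw [heq _ (φ.map_target hu), φ.right_inv hu]
  have hzero : ∀ᶠ t in 𝓝 t₀, (e.symm ((ψ ∘ γ) t)).2 = 0 := by
    refine eventually_snd_eq_zero_of_hasDerivAt e (W := vectorFieldInChart X ψ)
      (hX ψ hψ _ hγs) ?_ (congrArg Prod.snd hsymm) ?_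
    · filter_upwards [hγ, hsrc] with t ht hts
      exact hasDerivAt_comp_of_hasMFDerivAt hψ hts ht
    · filter_upwards [hφp] with u hu
      have hu' := φ.map_target hu
      rw [← hpoint u hu, vectorFieldInChart_apply X (hmaps hu')]
      exact (mem_range_mfderiv_iff hdiff hφ hψ hmaps heq hu' _).1 (htan _)
  filter_upwards [hzero, hsrc, hcont.eventually_mem hφp] with t ht hts htφ
  have h1 : ψ (γ t) = ψ (φ.symm (e.symm (ψ (γ t))).1 : L) := by
    rw [hpoint _ htφ, ← ht]
    exact (e.apply_symm_apply _).symm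
  rw [ψ.injOn hts (hmaps (φ.map_target htφ)) h1]
  exact Subtype.coe_prop _

/-- In adapted charts the transversal component of the integral curve through `p` vanishes near time
`0`, hence so does its derivative, the transversal component of `X p`. -/
theorem tangent_of_isLocallyFlowInvariant {X : (x : M) → TangentSpace 𝓘(ℝ, E) x} {L : Set M}
    [ChartedSpace F L] (hL : IsSmoothEmbedding 𝓘(ℝ, F) 𝓘(ℝ, E) ∞ (Subtype.val : L → M))
    (hX : ∀ x : M, ∃ γ : ℝ → M, γ 0 = x ∧ IsMIntegralCurveAt γ X 0)
    (hinv : IsLocallyFlowInvariant X L) (p : L) :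
    X p ∈ range (mfderiv 𝓘(ℝ, F) 𝓘(ℝ, E) (Subtype.val : L → M) p) := by
  obtain ⟨G, _, _, e, φ, hφ, ψ, hψ, hpφ, hmaps, heq⟩ :=
    exists_charts_of_isImmersionAt (hL.isImmersion.isImmersionAt p)
  have hdiff : MDifferentiable 𝓘(ℝ, F) 𝓘(ℝ, E) (Subtype.val : L → M) :=
    hL.isImmersion.contMDiff.mdifferentiable (by simp)
  rw [mem_range_mfderiv_iff hdiff hφ hψ hmaps heq hpφ]
  obtain ⟨γ, hγ₀, hγ⟩ := hX p
  have hγs : γ 0 ∈ ψ.source := hγ₀ ▸ hmaps hpφ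
  -- `L` has the subspace topology, so the chart domain is the trace of an open set of `M`; a curve
  -- in `L` that is continuous in `M` thus stays in that domain for a short time.
  obtain ⟨U, hU, hUφ⟩ := isOpen_induced_iff.1 φ.open_source
  have hpU : γ 0 ∈ U := by
    have : p ∈ Subtype.val ⁻¹' U := hUφ ▸ hpφ
    rw [hγ₀]
    exact this
  have hzero : (fun t => (e.symm ((ψ ∘ γ) t)).2) =ᶠ[𝓝 0] fun _ => (0 : G) := by
    filter_upwards [hinv γ 0 hγ (hγ₀ ▸ p.2), hγ.continuousAt.eventually_mem (hU.mem_nhds hpU)]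
      with t htL htU
    have hq : (⟨γ t, htL⟩ : L) ∈ φ.source := hUφ ▸ htU
    simp [heq _ hq]
  let P : E →L[ℝ] G := (ContinuousLinearMap.snd ℝ F G).comp (e.symm : E →L[ℝ] F × G)
  have hd : HasDerivAt (fun t => P ((ψ ∘ γ) t)) (P (vectorFieldInChart X ψ (ψ (γ 0)))) 0 :=
    P.hasFDerivAt.comp_hasDerivAt 0 (hasDerivAt_comp_of_hasMFDerivAt hψ hγs hγ.self_of_nhds)
  have h0 : P (vectorFieldInChart X ψ (ψ (γ 0))) = 0 :=
    hd.unique ((hasDerivAt_const (0 : ℝ) (0 : G)).congr_of_eventuallyEq hzero)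
  rw [hγ₀, vectorFieldInChart_apply X (hmaps hpφ)] at h0
  exact h0

variable [FiniteDimensional ℝ E]

/-- The Hamiltonian vector field of `h` is tangent to a connected Lagrangian submanifold iff `h` is
constant on it. -/
theorem hamiltonianVectorField_tangent_iff (Ω : SymplecticForm E M) {h : M → ℝ}
    (hh : ContMDiff 𝓘(ℝ, E) 𝓘(ℝ, ℝ) ∞ h) {L : Set M} [ChartedSpace F L]
    (hL : IsLagrangianSubmanifold (F := F) Ω L) (hconn : IsPreconnected L) :
    (∀ p : L, hamiltonianVectorField Ω h p ∈
      range (mfderiv 𝓘(ℝ, F) 𝓘(ℝ, E) (Subtype.val : L → M) p)) ↔ ∃ c : ℝ, L ⊆ h ⁻¹' {c} := by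
  have := hL.isManifold
  have : PreconnectedSpace L := Subtype.preconnectedSpace hconn
  have hdiff : MDifferentiable 𝓘(ℝ, F) 𝓘(ℝ, E) (Subtype.val : L → M) :=
    hL.isSmoothEmbedding.isImmersion.contMDiff.mdifferentiable (by simp)
  have hhd : MDifferentiable 𝓘(ℝ, E) 𝓘(ℝ, ℝ) h := hh.mdifferentiable (by simp)
  have hder : ∀ (p : L) (u : TangentSpace 𝓘(ℝ, F) p),
      Ω.form p ![mfderiv 𝓘(ℝ, F) 𝓘(ℝ, E) (Subtype.val : L → M) p u,
        hamiltonianVectorField Ω h p] =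
      mfderiv 𝓘(ℝ, F) 𝓘(ℝ, ℝ) (h ∘ (Subtype.val : L → M)) p u := by
    intro p u
    rw [form_hamiltonianVectorField, mfderiv_comp (I' := 𝓘(ℝ, E)) p (hhd _) (hdiff p)]
    rfl
  constructor
  · intro ht
    obtain ⟨c, hc⟩ := exists_forall_eq_of_mfderiv_eq_zero (hhd.comp hdiff) fun p u =>
      (hder p u).symm.trans ((hL.lagrangian p _).1 (ht p) u)
    exact ⟨c, fun x hx => hc ⟨x, hx⟩⟩
  · rintro ⟨c, hc⟩ p
    refine (hL.lagrangian p _).2 fun u => (hder p u).trans ?_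
    have hconst : h ∘ (Subtype.val : L → M) = fun _ => c := funext fun q => hc q.2
    rw [hconst, mfderiv_const]
    rfl

theorem isLocallyFlowInvariant_hamiltonianVectorField_iff [IsManifold 𝓘(ℝ, E) ∞ M]
    (Ω : SymplecticForm E M) {h : M → ℝ} (hh : ContMDiff 𝓘(ℝ, E) 𝓘(ℝ, ℝ) ∞ h)
    {L : Set M} [ChartedSpace F L]
    (hL : IsLagrangianSubmanifold (F := F) Ω L) (hconn : IsPreconnected L) :
    IsLocallyFlowInvariant (hamiltonianVectorField Ω h) L ↔ ∃ c : ℝ, L ⊆ h ⁻¹' {c} := by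
  have : IsManifold 𝓘(ℝ, E) 1 M := .of_le (n := ∞) (by simp)
  have : CompleteSpace E := FiniteDimensional.complete ℝ E
  rw [← hamiltonianVectorField_tangent_iff Ω hh hL hconn]
  refine ⟨tangent_of_isLocallyFlowInvariant hL.isSmoothEmbedding fun x => ?_,
    isLocallyFlowInvariant_of_tangent hL.isSmoothEmbedding fun ψ hψ x hx =>
      contDiffAt_vectorFieldInChart Ω hh hψ hx⟩
  exact exists_isMIntegralCurveAt_of_contMDiffAt_boundaryless 0
    (contMDiffAt_hamiltonianVectorField Ω hh x)

end Invariance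

/-! ### From local to global invariance -/

section Closed

variable {E : Type*} [NormedAddCommGroup E] [NormedSpace ℝ E]
  {M : Type*} [TopologicalSpace M] [ChartedSpace E M]

theorem IsFlowInvariant.isLocallyFlowInvariant {X : (x : M) → TangentSpace 𝓘(ℝ, E) x} {L : Set M}
    (hinv : IsFlowInvariant X L) : IsLocallyFlowInvariant X L := by
  intro γ t₀ hγ h₀
  obtain ⟨ε, hε, hball⟩ := isMIntegralCurveAt_iff'.1 hγ
  rw [Real.ball_eq_Ioo] at hball
  filter_upwards [Ioo_mem_nhds (by linarith : t₀ - ε < t₀) (by linarith : t₀ < t₀ + ε)] with t ht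
  exact hinv γ _ _ hball t₀ ⟨by linarith, by linarith⟩ h₀ t ht

theorem IsLocallyFlowInvariant.isFlowInvariant {X : (x : M) → TangentSpace 𝓘(ℝ, E) x} {L : Set M}
    (hinv : IsLocallyFlowInvariant X L) (hL : IsClosed L) : IsFlowInvariant X L := by
  intro γ a b hγ t₀ ht₀ h₀
  have hcont : Continuous ((Ioo a b).domRestrict γ) := hγ.continuousOn.domRestrict
  -- Closedness of this set of times comes from that of `L`, openness from local invariance.
  have hclopen : IsClopen ((Ioo a b).domRestrict γ ⁻¹' L) := by
    refine ⟨hL.preimage hcont, isOpen_iff_mem_nhds.2 fun s hs => ?_⟩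
    have h1 := hinv γ s (hγ.isMIntegralCurveAt (Ioo_mem_nhds s.2.1 s.2.2)) hs
    exact continuous_subtype_val.continuousAt.eventually h1
  have : PreconnectedSpace (Ioo a b) := Subtype.preconnectedSpace isPreconnected_Ioo
  have huniv := hclopen.eq_univ ⟨⟨t₀, ht₀⟩, h₀⟩
  intro t ht
  have : (⟨t, ht⟩ : Ioo a b) ∈ (Ioo a b).domRestrict γ ⁻¹' L := huniv ▸ mem_univ _
  exact this

end Closed

end HamiltonianSystem

theorem mainTheorem6
    {E : Type*} [NormedAddCommGroup E] [NormedSpace ℝ E] [FiniteDimensional ℝ E]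
    {M : Type*} [TopologicalSpace M] [T2Space M] [ChartedSpace E M] [IsManifold 𝓘(ℝ, E) ∞ M]
    (Ω : HamiltonianSystem.SymplecticForm E M)
    (h : M → ℝ) (hh : ContMDiff 𝓘(ℝ, E) 𝓘(ℝ, ℝ) ∞ h)
    {F : Type*} [NormedAddCommGroup F] [NormedSpace ℝ F] [FiniteDimensional ℝ F]
    (L : Set M) [ChartedSpace F L]
    (hL : HamiltonianSystem.IsLagrangianSubmanifold (F := F) Ω L)
    (hconn : IsPreconnected L) :
    (HamiltonianSystem.IsLocallyFlowInvariant (HamiltonianSystem.hamiltonianVectorField Ω h) L ↔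
      ∃ c : ℝ, L ⊆ h ⁻¹' {c}) ∧
    (IsClosed L →
      (HamiltonianSystem.IsFlowInvariant (HamiltonianSystem.hamiltonianVectorField Ω h) L ↔
        ∃ c : ℝ, L ⊆ h ⁻¹' {c})) := by
  have hloc := HamiltonianSystem.isLocallyFlowInvariant_hamiltonianVectorField_iff Ω hh hL hconn
  exact ⟨hloc, fun hcl => ⟨fun hinv => hloc.1 hinv.isLocallyFlowInvariant,
    fun hc => (hloc.2 hc).isFlowInvariant hcl⟩⟩
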